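/- Let $M$ be a topological monoid (a monoid with a topology for which multiplication $M\times M\to M$ is continuous), let $\sigma\colon M\to M$ be an involutive anti-automorphism, i.e. $\sigma(xy)=\sigma(y)\sigma(x)$ and $\sigma(\sigma(x))=x$ for all $x,y\in M$, and let $\mu$ be a complex measure on the Borel $\sigma$-algebra of $M$ with compact support, i.e. there is a compact set $K\subseteq M$ such that $\mu(A)=0$ for every Borel set $A\subseteq M\setminus K$. Let $\delta>0$. If a continuous function $f\colon M\to\mathbb{C}$ satisfies $$\left|\int_M f(xyt)\,d\mu(t)+\int_M f(x\sigma(y)t)\,d\mu(t)-2f(x)f(y)\right|\le\delta\qquad\text{for all }x,y\in M,$$ then either $f$ is bounded on $M$, or $f$ is a solution of the integral Kannappan functional equation $$\int_M f(xyt)\,d\mu(t)+\int_M f(x\sigma(y)t)\,d\mu(t)=2f(x)f(y)\qquad\text{for all }x,y\in M.$$ -/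

import Mathlib

open MeasureTheory

/-- A complex measure `μ` on (a σ-algebra of) a topological space `X` has compact support if it
is concentrated on some compact set `K`: every measurable set disjoint from `K` is `μ`-null,
and hence, as its measurable subsets are disjoint from `K` too, null for the total variation
of `μ`. -/
def HasCompactlySupportedMass {X : Type*} [TopologicalSpace X] [MeasurableSpace X]
    (μ : ComplexMeasure X) : Prop :=
  ∃ K : Set X, IsCompact K ∧ ∀ A : Set X, MeasurableSet A → Disjoint A K → μ A = 0

/-- `σ` is an involutive anti-automorphism of the monoid `M`. (An involution is bijective, and a
surjective anti-multiplicative map fixes the identity, so neither has to be listed.) -/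
structure IsInvolutiveAntiAutomorphism {M : Type*} [Monoid M] (σ : M → M) : Prop where
  map_mul_rev : ∀ x y : M, σ (x * y) = σ y * σ x
  involutive : ∀ x : M, σ (σ x) = x

/-- The integral `∫ g dμ` of a complex function against a complex measure: Mathlib's integral
against a vector measure, for the pairing `(a, b) ↦ a * b` of complex numbers. -/
noncomputable def complexIntegral {X : Type*} [MeasurableSpace X]
    (μ : ComplexMeasure X) (g : X → ℂ) : ℂ :=
  ∫ᵛ t, g t ∂[ContinuousLinearMap.mul ℝ ℂ; μ]

/-! Put `E x = ∫ f(xt) dμ(t)` and `c = f 1`, with `f` unbounded. Taking `y = 1` shows `E - c f` is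
bounded, so `c ≠ 0` and `f / c` satisfies d'Alembert's equation up to a bounded error. A bounded
expression of the form `g w * a`, with `g` unbounded, forces `a = 0`; this makes `f / c` an exact,
even, central solution, and then gives `E = c f`. -/

open Asymptotics in
/-- A complex number whose product with an unbounded function is bounded vanishes. -/
theorem eq_zero_of_mul_isBigO_one {X : Type*} {g : X → ℂ} (hg : ¬ ∃ C : ℝ, ∀ x, ‖g x‖ ≤ C) {a : ℂ}
    (h : (fun x => g x * a) =O[⊤] (fun _ => (1 : ℝ))) : a = 0 := by
  by_contra ha
  obtain ⟨C, hC⟩ := isBigO_top.1 h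
  refine hg ⟨C / ‖a‖, fun x => ?_⟩
  rw [le_div_iff₀ (norm_pos_iff.2 ha), ← norm_mul]
  simpa using hC x

namespace IsInvolutiveAntiAutomorphism

variable {M : Type*} [Monoid M] {σ : M → M}

theorem map_one (hσ : IsInvolutiveAntiAutomorphism σ) : σ 1 = 1 := by
  simpa [hσ.involutive] using (hσ.map_mul_rev (σ 1) 1).symm

open Asymptotics in
/-- An unbounded approximate solution of d'Alembert's equation is invariant under the
anti-involution. -/
theorem comp_eq_of_approx_dAlembert (hσ : IsInvolutiveAntiAutomorphism σ) {g : M → ℂ}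
    (hg : ¬ ∃ C : ℝ, ∀ x, ‖g x‖ ≤ C) {D : ℝ}
    (hD : ∀ x y, ‖g (x * y) + g (x * σ y) - 2 * g x * g y‖ ≤ D) (y : M) : g (σ y) = g y := by
  have hF : ∀ y, (fun x => g (x * y) + g (x * σ y) - 2 * g x * g y) =O[⊤] (fun _ => (1 : ℝ)) :=
    fun y => isBigO_top.2 ⟨D, fun x => by simpa using hD x y⟩
  refine sub_eq_zero.1 (eq_zero_of_mul_isBigO_one hg
    ((((hF y).sub (hF (σ y))).const_mul_left (1 / 2)).congr_left fun x => ?_))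
  rw [hσ.involutive]
  ring

open Asymptotics in
/-- Superstability of d'Alembert's functional equation on a monoid with an anti-involution. -/
theorem dAlembert_of_approx (hσ : IsInvolutiveAntiAutomorphism σ) {g : M → ℂ}
    (hg : ¬ ∃ C : ℝ, ∀ x, ‖g x‖ ≤ C) {D : ℝ}
    (hD : ∀ x y, ‖g (x * y) + g (x * σ y) - 2 * g x * g y‖ ≤ D) (x y : M) :
    g (x * y) + g (x * σ y) = 2 * g x * g y := by
  have even := hσ.comp_eq_of_approx_dAlembert hg hD
  have hF : ∀ u v : M → M, (fun w => g (u w * v w) + g (u w * σ (v w)) - 2 * g (u w) * g (v w))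
      =O[⊤] (fun _ => (1 : ℝ)) :=
    fun u v => isBigO_top.2 ⟨D, fun w => by simpa using hD (u w) (v w)⟩
  have central : ∀ u v : M → M, (fun w => g (u w * v w) - g (v w * u w))
      =O[⊤] (fun _ => (1 : ℝ)) := fun u v => by
    refine ((hF u v).sub (hF v u)).congr_left fun w => ?_
    -- Evenness cancels the second terms, as `σ (v * σ u) = u * σ v`.
    rw [← even (v w * σ (u w)), hσ.map_mul_rev, hσ.involutive]
    ring
  -- Moving `σ x` to the left of `w`, up to bounded error, leaves `y` or `σ y` last; all terms then
  -- cancel except `2 * g w` times the defect at `(x, y)`.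
  refine sub_eq_zero.1 (eq_zero_of_mul_isBigO_one hg (IsBigO.congr_left (IsBigO.const_mul_left
    (((((((central (fun w => w * σ y) (fun _ => σ x)).add
      (central (fun w => w * y) (fun _ => σ x))).add
      (hF (fun w => σ x * w) (fun _ => y))).sub
      ((central (fun w => w) (fun _ => σ x)).const_mul_left (2 * g y))).sub
      (hF (fun w => w) (fun _ => x * y))).sub
      (hF (fun w => w) (fun _ => x * σ y))).add
      (((hF (fun w => w) (fun _ => x)).const_mul_left (2 * g y)).add
      (hF (fun w => w * x) (fun _ => y)))) (1 / 2)) fun w => ?_))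
  simp only [hσ.map_mul_rev, hσ.involutive, mul_assoc]
  ring

/-- Solutions of d'Alembert's equation that are invariant under the anti-involution are central. -/
theorem map_mul_comm_of_dAlembert (hσ : IsInvolutiveAntiAutomorphism σ) {g : M → ℂ}
    (even : ∀ x, g (σ x) = g x) (h : ∀ x y, g (x * y) + g (x * σ y) = 2 * g x * g y) (x y : M) :
    g (x * y) = g (y * x) := by
  have h1 := even (x * σ y)
  rw [hσ.map_mul_rev, hσ.involutive] at h1
  linear_combination h x y - h y x + h1

end IsInvolutiveAntiAutomorphism

namespace MeasureTheory.ComplexMeasure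

variable {X : Type*} [MeasurableSpace X]

instance isFiniteMeasure_variation (μ : ComplexMeasure X) : IsFiniteMeasure μ.variation := by
  refine isFiniteMeasure_of_le
    ((re μ).totalVariation + (im μ).totalVariation)
    (VectorMeasure.variation_le_of_forall_enorm_le fun A _ => ?_)
  rw [SignedMeasure.totalVariation_eq_variation, SignedMeasure.totalVariation_eq_variation,
    Measure.add_apply]
  refine le_trans ?_ (add_le_add (VectorMeasure.enorm_measure_le_variation (re μ) A)
    (VectorMeasure.enorm_measure_le_variation (im μ) A))
  rw [enorm_eq_nnnorm, enorm_eq_nnnorm, enorm_eq_nnnorm, ← ENNReal.coe_add, ENNReal.coe_le_coe,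
    ← NNReal.coe_le_coe]
  exact Complex.norm_le_abs_re_add_abs_im (μ A)

end MeasureTheory.ComplexMeasure

/-- The variation is finite and vanishes off where `h` obeys its bound on `K`. -/
theorem HasCompactlySupportedMass.integrable {X : Type*} [TopologicalSpace X] [MeasurableSpace X]
    [BorelSpace X] {μ : ComplexMeasure X} (hμ : HasCompactlySupportedMass μ) {h : X → ℂ}
    (hh : Continuous h) : Integrable h μ.variation := by
  obtain ⟨K, hK, hKμ⟩ := hμ
  obtain ⟨C, hC⟩ := hK.exists_bound_of_continuousOn hh.continuousOn
  refine Integrable.of_bound hh.measurable.aestronglyMeasurable C ?_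
  have hm : MeasurableSet {x | ¬ ‖h x‖ ≤ C} :=
    (measurableSet_le hh.norm.measurable measurable_const).compl
  exact (VectorMeasure.variation_apply_eq_zero hm).2 fun t ht htm =>
    hKμ t htm (Set.disjoint_left.2 fun x hx hxK => ht hx (hC x hxK))

section complexIntegral

variable {X : Type*} [MeasurableSpace X] {μ : ComplexMeasure X}

theorem complexIntegral_add {g h : X → ℂ} (hg : Integrable g μ.variation)
    (hh : Integrable h μ.variation) :
    complexIntegral μ (fun t => g t + h t) = complexIntegral μ g + complexIntegral μ h :=
  VectorMeasure.integral_fun_add hg hh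

theorem complexIntegral_const_mul (c : ℂ) (h : X → ℂ) :
    complexIntegral μ (fun t => c * h t) = c * complexIntegral μ h := by
  simp only [complexIntegral, VectorMeasure.integral_eq_setToFun]
  exact setToFun_smul _ (fun c s x => by
    simp [transpose_eq_cbmApplyMeasure, mul_assoc]) c h

end complexIntegral

theorem proposition3p3 {M : Type*} [Monoid M] [TopologicalSpace M] [ContinuousMul M]
    [MeasurableSpace M] [BorelSpace M]
    (σ : M → M) (hσ : IsInvolutiveAntiAutomorphism σ)
    (μ : ComplexMeasure M) (hμ : HasCompactlySupportedMass μ)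
    (δ : ℝ) (hδ : 0 < δ)
    (f : M → ℂ) (hf : Continuous f)
    (hfδ : ∀ x y : M,
      ‖complexIntegral μ (fun t => f (x * y * t)) + complexIntegral μ (fun t => f (x * σ y * t))
        - 2 * f x * f y‖ ≤ δ) :
    (∃ C : ℝ, ∀ x : M, ‖f x‖ ≤ C) ∨
      (∀ x y : M,
        complexIntegral μ (fun t => f (x * y * t)) + complexIntegral μ (fun t => f (x * σ y * t))
          = 2 * f x * f y) := by
  refine or_iff_not_imp_left.2 fun hub => ?_
  set E : M → ℂ := fun x => complexIntegral μ (fun t => f (x * t)) with hE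
  change ∀ x y, ‖E (x * y) + E (x * σ y) - 2 * f x * f y‖ ≤ δ at hfδ
  change ∀ x y, E (x * y) + E (x * σ y) = 2 * f x * f y
  set c := f 1 with hc
  have hEc : ∀ x, ‖E x - c * f x‖ ≤ δ / 2 := fun x => by
    have h := hfδ x 1
    rw [hσ.map_one, mul_one, show E x + E x - 2 * f x * f 1 = 2 * (E x - c * f x) by ring,
      norm_mul, Complex.norm_ofNat] at h
    linarith
  have happrox : ∀ x y, ‖c * f (x * y) + c * f (x * σ y) - 2 * f x * f y‖ ≤ 2 * δ := fun x y => by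
    rw [show c * f (x * y) + c * f (x * σ y) - 2 * f x * f y =
      E (x * y) + E (x * σ y) - 2 * f x * f y - (E (x * y) - c * f (x * y))
        - (E (x * σ y) - c * f (x * σ y)) by ring]
    linarith [norm_sub_le (E (x * y) + E (x * σ y) - 2 * f x * f y - (E (x * y) - c * f (x * y)))
        (E (x * σ y) - c * f (x * σ y)),
      norm_sub_le (E (x * y) + E (x * σ y) - 2 * f x * f y) (E (x * y) - c * f (x * y)),
      hfδ x y, hEc (x * y), hEc (x * σ y)]
  have hc0 : c ≠ 0 := fun h0 => hub ⟨0, fun y => by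
    refine (norm_eq_zero.2 (eq_zero_of_mul_isBigO_one hub
      (Asymptotics.isBigO_top.2 ⟨δ, fun x => ?_⟩))).le
    have h := happrox x y
    rw [h0, show 0 * f (x * y) + 0 * f (x * σ y) - 2 * f x * f y = -(2 * (f x * f y)) by ring,
      norm_neg, norm_mul, Complex.norm_ofNat] at h
    rw [norm_one]
    linarith⟩
  have hgub : ¬ ∃ C : ℝ, ∀ x, ‖f x / c‖ ≤ C := fun ⟨C, hC⟩ => hub ⟨C * ‖c‖, fun x => by
    have h := hC x
    rwa [norm_div, div_le_iff₀ (norm_pos_iff.2 hc0)] at h⟩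
  have hgapprox : ∀ x y, ‖f (x * y) / c + f (x * σ y) / c - 2 * (f x / c) * (f y / c)‖
      ≤ 2 * δ / ‖c ^ 2‖ := fun x y => by
    rw [show f (x * y) / c + f (x * σ y) / c - 2 * (f x / c) * (f y / c) =
      (c * f (x * y) + c * f (x * σ y) - 2 * f x * f y) / c ^ 2 by field_simp, norm_div]
    gcongr
    exact happrox x y
  have heven := hσ.comp_eq_of_approx_dAlembert hgub hgapprox
  have hdA := hσ.dAlembert_of_approx hgub hgapprox
  have hcomm : ∀ x y, f (x * y) = f (y * x) := fun x y =>
    (div_left_inj' hc0).1 (hσ.map_mul_comm_of_dAlembert (g := fun x => f x / c) heven hdA x y)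
  replace heven : ∀ x, f (σ x) = f x := fun x => (div_left_inj' hc0).1 (heven x)
  replace hdA : ∀ x y, c * f (x * y) + c * f (x * σ y) = 2 * f x * f y := fun x y => by
    have h := hdA x y
    field_simp at h
    linear_combination h
  have hint : ∀ x, Integrable (fun t => f (x * t)) μ.variation := fun x =>
    hμ.integrable (hf.comp (continuous_const_mul x))
  -- Integrate d'Alembert's equation at `(w, x * t)` over `t`; evenness and centrality turn `f (w *
  -- σ (x * t))` into `f (σ w * x * t)`.
  have hmul : ∀ w x, 2 * f w * E x = c * E (w * x) + c * E (σ w * x) := fun w x => by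
    simp only [hE, ← complexIntegral_const_mul]
    rw [← complexIntegral_add ((hint _).const_mul c) ((hint _).const_mul c)]
    congr 1
    ext t
    rw [← hdA, ← heven (w * σ (x * t)), hσ.map_mul_rev w, hσ.involutive, hcomm _ (σ w),
      mul_assoc, mul_assoc]
  have hO : ∀ u : M → M, (fun w => E (u w) - c * f (u w)) =O[⊤] (fun _ => (1 : ℝ)) :=
    fun u => Asymptotics.isBigO_top.2 ⟨δ / 2, fun w => by simpa using hEc (u w)⟩
  have hEeq : ∀ x, E x = c * f x := fun x => by
    -- By `hmul` and `hdA`, `f w * (E x - c * f x)` is bounded in `w`.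
    refine sub_eq_zero.1 (eq_zero_of_mul_isBigO_one hub
      ((((hO fun w => w * x).add (hO fun w => σ w * x)).const_mul_left (c / 2)).congr_left
        fun w => ?_))
    have h := hdA x w
    rw [hcomm x w, hcomm x (σ w)] at h
    linear_combination (-1 / 2) * hmul w x - c / 2 * h
  intro x y
  rw [hEeq, hEeq, hdA]
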